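/- Let $S$ be a completely $0$-simple semigroup (that is, $S$ has a zero, $S^2\neq\{0\}$, the only two-sided ideals of $S$ are $\{0\}$ and $S$, and $S$ has an idempotent that is minimal among its nonzero idempotents in the order $f\le e \iff ef=fe=f$). Assume that $S$ has more than two elements and that $S$ is not the three-element semigroup $\{0,a,b\}$ with zero $0$ and $xy=y$ for all $x,y\in\{a,b\}$ (the two-element right zero semigroup with a zero adjoined). Then $S$ is right subdirectly irreducible, i.e. the set of its non-diagonal right congruences (equivalence relations $\rho\neq\Delta_S$ with $x\mathrel{\rho}y\Rightarrow xs\mathrel{\rho}ys$ for all $s\in S$) has a least element with respect to inclusion, if and only if $S$ is a cocyclic $0$-group, i.e. $S$ is isomorphic to $G\cup\{0\}$, where $G$ is a group having a least nontrivial subgroup and $0$ is an externally adjoined zero. -/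

import Mathlib

/-- A (two-sided) ideal of a semigroup: a nonempty subset closed under left and right
multiplication by arbitrary elements. -/
def IsSemigroupIdeal {S : Type*} [Semigroup S] (I : Set S) : Prop :=
  I.Nonempty ∧ ∀ x ∈ I, ∀ s : S, s * x ∈ I ∧ x * s ∈ I

/-- A semigroup with zero is 0-simple if its multiplication is not identically zero
and its only ideals are `{0}` and the whole semigroup. -/
def IsZeroSimple (S : Type*) [SemigroupWithZero S] : Prop :=
  (∃ x y : S, x * y ≠ 0) ∧ ∀ I : Set S, IsSemigroupIdeal I → I = {0} ∨ I = Set.univ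

/-- A primitive idempotent: a nonzero idempotent which is minimal among the nonzero idempotents
for the natural partial order `f ≤ e ↔ e * f = f ∧ f * e = f`. -/
def IsPrimitiveIdempotent {S : Type*} [SemigroupWithZero S] (e : S) : Prop :=
  e ≠ 0 ∧ IsIdempotentElem e ∧
    ∀ f : S, f ≠ 0 → IsIdempotentElem f → e * f = f → f * e = f → f = e

/-- A completely 0-simple semigroup: a 0-simple semigroup with a primitive idempotent. -/
def IsCompletelyZeroSimple (S : Type*) [SemigroupWithZero S] : Prop :=
  IsZeroSimple S ∧ ∃ e : S, IsPrimitiveIdempotent e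

/-- A right congruence: an equivalence relation compatible with right multiplication. -/
def IsRightCongruence {S : Type*} [Semigroup S] (r : Setoid S) : Prop :=
  ∀ a b s : S, r a b → r (a * s) (b * s)

/-- A semigroup is right subdirectly irreducible if its set of non-diagonal right congruences
has a least element (`⊥ : Setoid S` is equality). -/
def IsRightSubdirectlyIrreducible (S : Type*) [Semigroup S] : Prop :=
  ∃ r : Setoid S, IsLeast {q : Setoid S | IsRightCongruence q ∧ q ≠ ⊥} r

/-- A cocyclic group: a group with a least nontrivial subgroup. -/
def IsCocyclicGroup (G : Type*) [Group G] : Prop :=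
  ∃ H : Subgroup G, IsLeast {K : Subgroup G | K ≠ ⊥} H

/-- A cocyclic 0-group: a semigroup isomorphic to a cocyclic group with a zero adjoined. -/
def IsCocyclicZeroGroup.{u} (S : Type u) [Semigroup S] : Prop :=
  ∃ (G : Type u) (_ : Group G), IsCocyclicGroup G ∧ Nonempty (S ≃* WithZero G)

/-- The three-element semigroup `{0, a, b}` obtained by adjoining a zero to the two-element right
zero semigroup `{a, b}` (up to isomorphism). -/
def IsRightZeroPairWithZero (S : Type*) [SemigroupWithZero S] : Prop :=
  Nat.card S = 3 ∧ ∀ x y : S, x ≠ 0 → x * y = y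

/-! Any two non-diagonal right congruences must share a pair of distinct elements, so pairs of right
congruences with trivial intersection drive the forward direction. Let `e` be a primitive
idempotent. Collapsing the right ideals `eS` and `seS` forces `e` to be a left identity. Then the
kernel of `x ↦ x * e` and Green's relation `L` meet trivially
(`eq_of_mulRightKernel_of_leftGreenSetoid`), so one of them is equality. If `L` is, the nonzero
elements form a right zero semigroup, which leads to the excluded case. If the kernel is, `e` is a
two-sided identity and `S` is a group with zero. There the non-universal right congruences are coset
partitions, so a least congruence amounts to a least nontrivial subgroup. -/

section RightCongruences

/-- The setoid collapsing the set `A` to a single class. -/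
def collapseSetoid {S : Type*} (A : Set S) : Setoid S where
  r x y := x = y ∨ (x ∈ A ∧ y ∈ A)
  iseqv :=
    { refl := fun _ => Or.inl rfl
      symm := by
        rintro x y (h | ⟨h, h'⟩)
        · exact Or.inl h.symm
        · exact Or.inr ⟨h', h⟩
      trans := by
        rintro x y z (rfl | ⟨h, h'⟩) (rfl | ⟨k, k'⟩)
        · exact Or.inl rfl
        · exact Or.inr ⟨k, k'⟩
        · exact Or.inr ⟨h, h'⟩
        · exact Or.inr ⟨h, k'⟩ }

theorem setoid_ne_bot_iff {S : Type*} {r : Setoid S} : r ≠ ⊥ ↔ ∃ x y, r x y ∧ x ≠ y := by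
  constructor
  · intro h
    by_contra! hc
    exact h (le_bot_iff.1 fun x y hxy => hc x y hxy)
  · rintro ⟨x, y, hxy, hne⟩ rfl
    exact hne hxy

theorem collapseSetoid_ne_bot {S : Type*} {A : Set S} {x y : S} (hx : x ∈ A) (hy : y ∈ A)
    (h : x ≠ y) : collapseSetoid A ≠ ⊥ :=
  setoid_ne_bot_iff.2 ⟨x, y, Or.inr ⟨hx, hy⟩, h⟩

/-- In a right subdirectly irreducible semigroup, two non-diagonal right congruences share a
pair of distinct elements. -/
theorem IsRightSubdirectlyIrreducible.exists_common {S : Type*} [Semigroup S]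
    (h : IsRightSubdirectlyIrreducible S) {p q : Setoid S} (hp : IsRightCongruence p)
    (hp' : p ≠ ⊥) (hq : IsRightCongruence q) (hq' : q ≠ ⊥) : ∃ x y, p x y ∧ q x y ∧ x ≠ y := by
  obtain ⟨r, ⟨-, hr⟩, hle⟩ := h
  obtain ⟨x, y, hxy, hne⟩ := setoid_ne_bot_iff.1 hr
  exact ⟨x, y, hle ⟨hp, hp'⟩ hxy, hle ⟨hq, hq'⟩ hxy, hne⟩

theorem IsRightCongruence.comap {S T : Type*} [Semigroup S] [Semigroup T] (f : S ≃* T)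
    {r : Setoid T} (hr : IsRightCongruence r) : IsRightCongruence (Setoid.comap f r) := by
  intro a b s hab
  change r (f (a * s)) (f (b * s))
  rw [map_mul, map_mul]
  exact hr _ _ _ hab

theorem setoid_comap_ne_bot {S T : Type*} (f : S ≃ T) {r : Setoid T} (hr : r ≠ ⊥) :
    Setoid.comap f r ≠ ⊥ := by
  obtain ⟨x, y, hxy, hne⟩ := setoid_ne_bot_iff.1 hr
  refine setoid_ne_bot_iff.2 ⟨f.symm x, f.symm y, ?_, fun h => hne (f.symm.injective h)⟩
  change r (f (f.symm x)) (f (f.symm y))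
  simpa using hxy

theorem IsRightSubdirectlyIrreducible.of_mulEquiv {S T : Type*} [Semigroup S] [Semigroup T]
    (f : S ≃* T) (h : IsRightSubdirectlyIrreducible S) : IsRightSubdirectlyIrreducible T := by
  obtain ⟨r, ⟨hr, hr'⟩, hle⟩ := h
  refine ⟨Setoid.comap f.symm r, ⟨hr.comap f.symm, setoid_comap_ne_bot f.symm.toEquiv hr'⟩, ?_⟩
  rintro q ⟨hq, hq'⟩ x y hxy
  have := hle ⟨hq.comap f, setoid_comap_ne_bot f.toEquiv hq'⟩ (show r (f.symm x) (f.symm y) from hxy)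
  change q (f (f.symm x)) (f (f.symm y)) at this
  simpa using this

end RightCongruences

/-! ### Right congruences on a group with zero versus subgroups. -/

section ZeroGroups

variable {G : Type*} [Group G]

/-- The partition of `WithZero G` into `{0}` and the right cosets of `K`. -/
def cosetSetoid (K : Subgroup G) : Setoid (WithZero G) where
  r x y := ∃ k ∈ K, x = (k : WithZero G) * y
  iseqv :=
    { refl := fun x => ⟨1, K.one_mem, by simp⟩
      symm := by
        rintro x y ⟨k, hk, rfl⟩
        refine ⟨k⁻¹, K.inv_mem hk, ?_⟩
        rw [← mul_assoc, ← WithZero.coe_mul]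
        simp
      trans := by
        rintro x y z ⟨k, hk, rfl⟩ ⟨l, hl, rfl⟩
        refine ⟨k * l, K.mul_mem hk hl, ?_⟩
        rw [WithZero.coe_mul, mul_assoc] }

theorem isRightCongruence_cosetSetoid (K : Subgroup G) : IsRightCongruence (cosetSetoid K) := by
  rintro a b s ⟨k, hk, rfl⟩
  exact ⟨k, hk, mul_assoc _ _ _⟩

theorem cosetSetoid_ne_bot {K : Subgroup G} (hK : K ≠ ⊥) : cosetSetoid K ≠ ⊥ := by
  obtain ⟨⟨k, hk⟩, hne⟩ := K.ne_bot_iff_exists_ne_one.1 hK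
  refine setoid_ne_bot_iff.2 ⟨(k : G), 1, ⟨k, hk, by simp⟩, fun h => hne ?_⟩
  exact Subtype.ext (WithZero.coe_inj.1 h)

/-- The class of `1` of a right congruence on `WithZero G`, as a subgroup of `G`. -/
def congruenceSubgroup (r : Setoid (WithZero G)) (hr : IsRightCongruence r) : Subgroup G where
  carrier := {g | r (g : WithZero G) 1}
  one_mem' := r.refl _
  mul_mem' := by
    intro a b ha hb
    have := hr _ _ (b : WithZero G) ha
    rw [one_mul, ← WithZero.coe_mul] at this
    exact r.trans this hb
  inv_mem' := by
    intro a ha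
    have := hr _ _ ((a⁻¹ : G) : WithZero G) ha
    rw [one_mul, ← WithZero.coe_mul, mul_inv_cancel] at this
    exact r.symm this

theorem mem_congruenceSubgroup {r : Setoid (WithZero G)} {hr : IsRightCongruence r} {g : G} :
    g ∈ congruenceSubgroup r hr ↔ r (g : WithZero G) 1 := Iff.rfl

theorem mul_inv_mem_congruenceSubgroup {r : Setoid (WithZero G)} {hr : IsRightCongruence r}
    {x y : G} (h : r (x : WithZero G) y) : x * y⁻¹ ∈ congruenceSubgroup r hr := by
  have := hr _ _ ((y⁻¹ : G) : WithZero G) h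
  rwa [← WithZero.coe_mul, ← WithZero.coe_mul, mul_inv_cancel] at this

theorem cosetSetoid_le {r : Setoid (WithZero G)} (hr : IsRightCongruence r) {K : Subgroup G}
    (hK : K ≤ congruenceSubgroup r hr) : cosetSetoid K ≤ r := by
  rintro x y ⟨k, hk, rfl⟩
  have := hr _ _ y (mem_congruenceSubgroup.1 (hK hk))
  rwa [one_mul] at this

/-- A right congruence relating zero to a nonzero element is universal. -/
theorem IsRightCongruence.rel_zero {r : Setoid (WithZero G)} (hr : IsRightCongruence r) {x : G}
    (h : r (x : WithZero G) 0) (y : WithZero G) : r y 0 := by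
  have := hr _ _ (((x⁻¹ : G) : WithZero G) * y) h
  rwa [zero_mul, ← mul_assoc, ← WithZero.coe_mul, mul_inv_cancel, WithZero.coe_one, one_mul]
    at this

theorem congruenceSubgroup_ne_bot {r : Setoid (WithZero G)} (hr : IsRightCongruence r)
    (hne : ∃ x y : G, r (x : WithZero G) y ∧ x ≠ y) : congruenceSubgroup r hr ≠ ⊥ := by
  obtain ⟨x, y, hxy, hne⟩ := hne
  intro hbot
  have := mul_inv_mem_congruenceSubgroup (hr := hr) hxy
  rw [hbot, Subgroup.mem_bot] at this
  exact hne (mul_inv_eq_one.1 this)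

theorem IsCocyclicGroup.isRightSubdirectlyIrreducible_withZero (h : IsCocyclicGroup G) :
    IsRightSubdirectlyIrreducible (WithZero G) := by
  obtain ⟨H, hH, hle⟩ := h
  refine ⟨cosetSetoid H, ⟨isRightCongruence_cosetSetoid H, cosetSetoid_ne_bot hH⟩, ?_⟩
  rintro q ⟨hq, hq'⟩
  obtain ⟨x, y, hxy, hne⟩ := setoid_ne_bot_iff.1 hq'
  have huniv : ∀ z : G, q (z : WithZero G) 0 → cosetSetoid H ≤ q := fun z hz a b _ =>
    q.trans (hq.rel_zero hz a) (q.symm (hq.rel_zero hz b))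
  induction x using WithZero.recZeroCoe with
  | zero =>
    induction y using WithZero.recZeroCoe with
    | zero => exact absurd rfl hne
    | coe y => exact huniv y (q.symm hxy)
  | coe x =>
    induction y using WithZero.recZeroCoe with
    | zero => exact huniv x hxy
    | coe y =>
      exact cosetSetoid_le hq (hle (congruenceSubgroup_ne_bot hq
        ⟨x, y, hxy, fun h => hne (congrArg _ h)⟩))

theorem IsRightSubdirectlyIrreducible.isCocyclicGroup [Nontrivial G]
    (h : IsRightSubdirectlyIrreducible (WithZero G)) : IsCocyclicGroup G := by
  obtain ⟨r, ⟨hr, hr'⟩, hle⟩ := h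
  refine ⟨congruenceSubgroup r hr, congruenceSubgroup_ne_bot hr ?_, ?_⟩
  · obtain ⟨x, y, hxy, hne⟩ := setoid_ne_bot_iff.1 hr'
    -- The partition into `{0}` and `G` is non-diagonal because `G` is nontrivial, so the least
    -- congruence refines it and never links zero to a group element.
    obtain ⟨k, -, rfl⟩ := hle ⟨isRightCongruence_cosetSetoid ⊤, cosetSetoid_ne_bot top_ne_bot⟩ hxy
    induction y using WithZero.recZeroCoe with
    | zero => simp at hne
    | coe y =>
      rw [← WithZero.coe_mul] at hxy hne
      exact ⟨k * y, y, hxy, fun h => hne (congrArg _ h)⟩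
  · intro K hK g hg
    obtain ⟨k, hk, hgk⟩ := hle ⟨isRightCongruence_cosetSetoid K, cosetSetoid_ne_bot hK⟩
      (mem_congruenceSubgroup.1 hg)
    rw [mul_one, WithZero.coe_inj] at hgk
    exact hgk ▸ hk

end ZeroGroups

/-! ### Reduction of a completely 0-simple semigroup to a group with zero. -/

section CompletelyZeroSimple

variable {S : Type*} [SemigroupWithZero S]

/-- In a 0-simple semigroup, every nonzero element generates the whole semigroup as `S a S`. -/
theorem IsZeroSimple.exists_mul_mul_eq (hS : IsZeroSimple S) {a : S} (ha : a ≠ 0) (b : S) :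
    ∃ x y, x * a * y = b := by
  obtain ⟨⟨p, q, hpq⟩, hI⟩ := hS
  have hsq : ∀ c : S, ∃ x y, x * y = c := by
    rcases hI {c | ∃ x y, x * y = c} ⟨⟨0, 0, 0, mul_zero 0⟩, by
        rintro _ ⟨x, y, rfl⟩ s
        exact ⟨⟨s * x, y, mul_assoc _ _ _⟩, ⟨x, y * s, (mul_assoc _ _ _).symm⟩⟩⟩ with h | h
    · exact absurd (h.subset ⟨p, q, rfl⟩) hpq
    · exact fun c => h.symm.subset (Set.mem_univ c)
  rcases hI {c | ∃ x y, x * a * y = c} ⟨⟨0, 0, 0, by simp⟩, by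
      rintro _ ⟨x, y, rfl⟩ s
      exact ⟨⟨s * x, y, by simp only [mul_assoc]⟩, ⟨x, y * s, by simp only [mul_assoc]⟩⟩⟩ with h | h
  -- If `SaS = 0`, the ideal of all `c` with `ScS = 0` contains `a ≠ 0`, hence is `S`. Then `S³ =
  -- 0`, against `S² = S` and `p * q ≠ 0`.
  · have hann : {c : S | ∀ x y, x * c * y = 0} = Set.univ := by
      refine (hI _ ⟨⟨0, by simp⟩, ?_⟩).resolve_left fun h0 =>
        ha (h0.subset fun x y => h.subset ⟨x, y, rfl⟩)
      intro c hc s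
      refine ⟨fun x y => ?_, fun x y => ?_⟩
      · rw [← mul_assoc x]
        exact hc _ _
      · rw [← mul_assoc x, mul_assoc _ s]
        exact hc _ _
    obtain ⟨u, v, rfl⟩ := hsq p
    exact absurd (hann.symm.subset (Set.mem_univ v) u q) hpq
  · exact h.symm.subset (Set.mem_univ b)

/-- If `e` is a primitive idempotent of a 0-simple semigroup, then `e S` is a 0-minimal right
ideal. -/
theorem IsPrimitiveIdempotent.exists_mul_eq (hS : IsZeroSimple S) {e : S}
    (he : IsPrimitiveIdempotent e) {a : S} (ha : a ≠ 0) (hea : e * a = a) : ∃ t, a * t = e := by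
  obtain ⟨he0, hee, hmin⟩ := he
  have hee : e * e = e := hee
  obtain ⟨x, y, hxy⟩ := hS.exists_mul_mul_eq ha e
  have huv : (e * x * e) * (a * y * e) = e := by
    calc (e * x * e) * (a * y * e) = e * (x * (e * a) * y) * e := by simp only [mul_assoc]
      _ = e := by rw [hea, hxy, hee, hee]
  have hev : e * (a * y * e) = a * y * e := by rw [← mul_assoc, ← mul_assoc, hea]
  have hve : (a * y * e) * e = a * y * e := by rw [mul_assoc, hee]
  have hue : (e * x * e) * e = e * x * e := by rw [mul_assoc, hee]
  generalize hu : e * x * e = u at *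
  generalize hv : a * y * e = v at *
  -- Since `u * v = e` with `u`, `v` in `eSe`, the product `v * u` is a nonzero idempotent below
  -- `e`, so it equals `e` by primitivity.
  refine ⟨y * e * u, ?_⟩
  rw [← mul_assoc, ← mul_assoc, hv]
  refine hmin _ ?_ ?_ ?_ ?_
  · intro h
    apply he0
    rw [← hee, ← huv]
    calc u * v * (u * v) = u * (v * u) * v := by simp only [mul_assoc]
      _ = 0 := by rw [h, mul_zero, zero_mul]
  · calc v * u * (v * u) = v * (u * v) * u := by simp only [mul_assoc]
      _ = v * u := by rw [huv, hve]
  · rw [← mul_assoc, hev]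
  · rw [mul_assoc, hue]

theorem isRightCongruence_collapseSetoid_range_mul (a : S) :
    IsRightCongruence (collapseSetoid (Set.range (a * ·))) := by
  rintro _ _ s (rfl | ⟨⟨x, rfl⟩, ⟨y, rfl⟩⟩)
  · exact Or.inl rfl
  · exact Or.inr ⟨⟨x * s, (mul_assoc _ _ _).symm⟩, ⟨y * s, (mul_assoc _ _ _).symm⟩⟩

/-- A primitive idempotent of a right subdirectly irreducible 0-simple semigroup is a left
identity. -/
theorem IsPrimitiveIdempotent.mul_eq_of_isRightSubdirectlyIrreducible (hS : IsZeroSimple S) {e : S}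
    (he : IsPrimitiveIdempotent e) (h : IsRightSubdirectlyIrreducible S) (a : S) : e * a = a := by
  have hee : e * e = e := he.2.1
  obtain ⟨s, t, hst⟩ := hS.exists_mul_mul_eq he.1 a
  by_contra hea
  have ha0 : a ≠ 0 := by
    rintro rfl
    exact hea (mul_zero e)
  obtain ⟨x, y, h1, h2, hne⟩ := h.exists_common
    (isRightCongruence_collapseSetoid_range_mul e)
    (collapseSetoid_ne_bot ⟨e, hee⟩ ⟨0, mul_zero e⟩ he.1)
    (isRightCongruence_collapseSetoid_range_mul (s * e))
    (collapseSetoid_ne_bot ⟨t, hst⟩ ⟨0, mul_zero _⟩ ha0)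
  -- A nonzero `b = e * c = s * e * d` would, by 0-minimality of `eS`, give `e * d * w = e`. Then `s
  -- * e = e * c * w` lies in `eS`, and so does `a = s * e * t`.
  have key : ∀ b : S, b ∈ Set.range (e * ·) → b ∈ Set.range (s * e * ·) → b = 0 := by
    rintro _ ⟨c, rfl⟩ ⟨d, hd⟩
    dsimp only at hd ⊢
    by_contra hb
    have hed : e * d ≠ 0 := by
      intro h0
      rw [mul_assoc, h0, mul_zero] at hd
      exact hb hd.symm
    obtain ⟨w, hw⟩ := he.exists_mul_eq hS hed (by rw [← mul_assoc, hee])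
    have hse : e * (s * e) = s * e := by
      have : s * e = e * c * w := by rw [← hd, mul_assoc s, mul_assoc s, hw]
      rw [this, mul_assoc, ← mul_assoc e, hee]
    exact hea (by rw [← hst, ← mul_assoc, hse])
  rcases h1 with h1 | ⟨hx, hy⟩
  · exact hne h1
  rcases h2 with h2 | ⟨hx', hy'⟩
  · exact hne h2
  exact hne ((key x hx hx').trans (key y hy hy').symm)

/-- The kernel of right multiplication by `e`. -/
def mulRightKernel (e : S) : Setoid S := Setoid.ker (· * e)

/-- The left identity lets `e` be inserted: `x * s * e = (x * e) * s * e`. -/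
theorem isRightCongruence_mulRightKernel {e : S} (hl : ∀ x, e * x = x) :
    IsRightCongruence (mulRightKernel e) := by
  intro x y s (hxy : x * e = y * e)
  change x * s * e = y * s * e
  rw [← hl s, ← mul_assoc x, ← mul_assoc y, hxy]

/-- Green's relation `L`, in a semigroup with a left identity `e`. -/
def leftGreenSetoid (e : S) (hl : ∀ x, e * x = x) : Setoid S where
  r x y := (∃ u, x = u * y) ∧ ∃ v, y = v * x
  iseqv :=
    { refl := fun x => ⟨⟨e, (hl x).symm⟩, ⟨e, (hl x).symm⟩⟩
      symm := fun h => ⟨h.2, h.1⟩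
      trans := by
        rintro x y z ⟨⟨u, hu⟩, v, hv⟩ ⟨⟨u', hu'⟩, v', hv'⟩
        exact ⟨⟨u * u', by rw [mul_assoc, ← hu', ← hu]⟩, ⟨v' * v, by rw [mul_assoc, ← hv, ← hv']⟩⟩ }

theorem isRightCongruence_leftGreenSetoid {e : S} (hl : ∀ x, e * x = x) :
    IsRightCongruence (leftGreenSetoid e hl) := by
  rintro x y s ⟨⟨u, hu⟩, v, hv⟩
  exact ⟨⟨u, by rw [← mul_assoc, ← hu]⟩, ⟨v, by rw [← mul_assoc, ← hv]⟩⟩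

theorem mul_ne_zero_of_left_identity {e : S} (he0 : e ≠ 0) (hl : ∀ x, e * x = x)
    (hr : ∀ a : S, a ≠ 0 → ∃ t, a * t = e) {a b : S} (ha : a ≠ 0) (hb : b ≠ 0) : a * b ≠ 0 := by
  intro hab
  obtain ⟨t, ht⟩ := hr a ha
  obtain ⟨w, hw⟩ := hr b hb
  apply he0
  rw [← ht, ← hl t, ← hw, mul_assoc b, ← mul_assoc a, hab, zero_mul]

/-- The intersection of `mulRightKernel` and `leftGreenSetoid` is trivial. -/
theorem eq_of_mulRightKernel_of_leftGreenSetoid {e : S} (he0 : e ≠ 0) (hl : ∀ x, e * x = x)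
    (hr : ∀ a : S, a ≠ 0 → ∃ t, a * t = e) {x y : S} (h1 : mulRightKernel e x y)
    (h2 : leftGreenSetoid e hl x y) : x = y := by
  obtain ⟨⟨u, rfl⟩, -⟩ := h2
  change u * y * e = y * e at h1
  rcases eq_or_ne y 0 with rfl | hy
  · exact mul_zero u
  obtain ⟨t, ht⟩ := hr _ (mul_ne_zero_of_left_identity he0 hl hr hy he0)
  -- `u` fixes `y * e`, hence also its right multiple `y * e * t = e`.
  have hue : u * e = e := by
    rw [← ht, ← mul_assoc, ← mul_assoc, h1]
  calc u * y = u * (e * y) := by rw [hl]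
    _ = y := by rw [← mul_assoc, hue, hl]

/-- The usual group argument: `t * e` is a right inverse of `x` and has a right inverse `w` itself.
Then `w = x * e`, so `t * e` is a left inverse of `x * e`. -/
theorem exists_left_inverse_mul {e : S} (he0 : e ≠ 0) (hl : ∀ x, e * x = x)
    (hr : ∀ a : S, a ≠ 0 → ∃ t, a * t = e) {x : S} (hx : x ≠ 0) :
    ∃ v, v ≠ 0 ∧ v * (x * e) = e := by
  obtain ⟨t, ht⟩ := hr x hx
  have ht0 : t ≠ 0 := by
    rintro rfl
    exact he0 (by rw [← ht, mul_zero])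
  have hte := mul_ne_zero_of_left_identity he0 hl hr ht0 he0
  obtain ⟨w, hw⟩ := hr _ hte
  refine ⟨t * e, hte, ?_⟩
  have hxt : x * (t * e) = e := by rw [← mul_assoc, ht, hl]
  have hxw : x * e = w := by
    calc x * e = x * (t * e) * w := by rw [mul_assoc, hw]
      _ = w := by rw [hxt, hl]
  rw [hxw, hw]

/-- A left identity with trivial `leftGreenSetoid` makes the nonzero elements a right zero
semigroup. -/
theorem mul_eq_right_of_leftGreenSetoid_eq_bot {e : S} (he0 : e ≠ 0) (hl : ∀ x, e * x = x)
    (hr : ∀ a : S, a ≠ 0 → ∃ t, a * t = e) (hbot : leftGreenSetoid e hl = ⊥) {x : S} (hx : x ≠ 0)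
    (y : S) : x * y = y := by
  obtain ⟨v, -, hv⟩ := exists_left_inverse_mul he0 hl hr hx
  have hrel : leftGreenSetoid e hl (x * e) e := ⟨⟨x, rfl⟩, v, hv.symm⟩
  rw [hbot] at hrel
  have hxe : x * e = e := hrel
  rw [← hl y, ← mul_assoc, hxe]

theorem exists_three_ne_zero (h2 : 2 < ENat.card S) (h3 : Nat.card S ≠ 3) :
    ∃ a b c : S, (a ≠ 0 ∧ b ≠ 0 ∧ c ≠ 0) ∧ a ≠ b ∧ a ≠ c ∧ b ≠ c := by
  have h4 : (4 : ℕ∞) ≤ ENat.card S := by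
    have h3' : (3 : ℕ∞) ≤ ENat.card S := Order.add_one_le_of_lt h2
    have hne : (3 : ℕ∞) ≠ ENat.card S := fun h => h3 (by
      rw [Nat.card, ← Cardinal.toNat_toENat]
      change ENat.toNat (ENat.card S) = 3
      rw [← h]; rfl)
    exact Order.add_one_le_of_lt (lt_of_le_of_ne h3' hne)
  have hcompl : (3 : ℕ∞) ≤ ({0}ᶜ : Set S).encard := by
    have := Set.encard_add_encard_compl ({0} : Set S)
    rw [Set.encard_singleton, Set.encard_univ] at this
    rw [← this, show (4 : ℕ∞) = 1 + 3 from rfl] at h4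
    exact (ENat.add_le_add_iff_left ENat.one_ne_top).1 h4
  obtain ⟨A, hA, hcard⟩ := Set.exists_subset_encard_eq hcompl
  obtain ⟨a, b, c, hab, hac, hbc, rfl⟩ := Set.encard_eq_three.1 hcard
  exact ⟨a, b, c, ⟨hA (by simp), hA (by simp), hA (by simp)⟩, hab, hac, hbc⟩

/-- In a right zero semigroup with zero adjoined, collapsing a set of nonzero elements is a right
congruence. -/
theorem isRightCongruence_collapseSetoid_of_rightZero (hz : ∀ x y : S, x ≠ 0 → x * y = y)
    {A : Set S} (hA : ∀ x ∈ A, x ≠ 0) : IsRightCongruence (collapseSetoid A) := by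
  rintro x y s (rfl | ⟨hx, hy⟩)
  · exact Or.inl rfl
  · exact Or.inl (by rw [hz x s (hA x hx), hz y s (hA y hy)])

theorem IsRightSubdirectlyIrreducible.isRightZeroPairWithZero
    (h : IsRightSubdirectlyIrreducible S) (h2 : 2 < ENat.card S)
    (hz : ∀ x y : S, x ≠ 0 → x * y = y) : IsRightZeroPairWithZero S := by
  refine ⟨?_, hz⟩
  by_contra h3
  obtain ⟨a, b, c, ⟨ha, hb, hc⟩, hab, hac, hbc⟩ := exists_three_ne_zero h2 h3
  -- Two pairs overlapping only in `b` give collapses with trivial intersection.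
  obtain ⟨x, y, h1, h2, hne⟩ := h.exists_common
    (isRightCongruence_collapseSetoid_of_rightZero hz (A := {a, b}) (by simp [ha, hb]))
    (collapseSetoid_ne_bot (x := a) (y := b) (by simp) (by simp) hab)
    (isRightCongruence_collapseSetoid_of_rightZero hz (A := {b, c}) (by simp [hb, hc]))
    (collapseSetoid_ne_bot (x := b) (y := c) (by simp) (by simp) hbc)
  rcases h1 with h1 | ⟨hx, hy⟩
  · exact hne h1
  rcases h2 with h2 | ⟨hx', hy'⟩
  · exact hne h2
  simp only [Set.mem_insert_iff, Set.mem_singleton_iff] at hx hy hx' hy'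
  grind

/-- A semigroup with zero whose nonzero elements have left inverses with respect to a nonzero
two-sided identity is a group with zero adjoined. -/
theorem exists_group_mulEquiv_withZero.{u} {S : Type u} [SemigroupWithZero S] {e : S}
    (he0 : e ≠ 0) (hl : ∀ x, e * x = x) (hmul : ∀ {a b : S}, a ≠ 0 → b ≠ 0 → a * b ≠ 0)
    (hinv : ∀ x : S, x ≠ 0 → ∃ v, v ≠ 0 ∧ v * x = e) :
    ∃ (G : Type u) (_ : Group G), Nonempty (S ≃* WithZero G) := by
  choose! i hi0 hi using hinv
  let G := {x : S // x ≠ 0}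
  let _ : Mul G := ⟨fun a b => ⟨a.1 * b.1, hmul a.2 b.2⟩⟩
  let _ : One G := ⟨⟨e, he0⟩⟩
  let _ : Inv G := ⟨fun a => ⟨i a.1, hi0 a.1 a.2⟩⟩
  let _ : Group G := Group.ofLeftAxioms (fun a b c => Subtype.ext (mul_assoc a.1 b.1 c.1))
    (fun a => Subtype.ext (hl a.1)) (fun a => Subtype.ext (hi a.1 a.2))
  let f : WithZero G → S := fun x => WithZero.recZeroCoe (motive := fun _ => S) 0 (fun g : G => g.1) x
  have f0 : f 0 = 0 := rfl
  have fc : ∀ g : G, f (g : WithZero G) = g.1 := fun _ => rfl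
  have hf : Function.Bijective f := by
    constructor
    · intro x y hxy
      induction x using WithZero.recZeroCoe with
      | zero =>
        induction y using WithZero.recZeroCoe with
        | zero => rfl
        | coe y => exact absurd hxy.symm y.2
      | coe x =>
        induction y using WithZero.recZeroCoe with
        | zero => exact absurd hxy x.2
        | coe y => exact congrArg _ (Subtype.ext hxy)
    · intro s
      rcases eq_or_ne s 0 with rfl | hs
      · exact ⟨0, rfl⟩
      · exact ⟨((⟨s, hs⟩ : G) : WithZero G), rfl⟩
  let F : WithZero G →ₙ* S :=
    { toFun := f
      map_mul' := by
        intro x y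
        induction x using WithZero.recZeroCoe with
        | zero => rw [zero_mul, f0, zero_mul]
        | coe x =>
          induction y using WithZero.recZeroCoe with
          | zero => rw [mul_zero, f0, mul_zero]
          | coe y => rw [← WithZero.coe_mul, fc, fc, fc]; rfl }
  exact ⟨G, inferInstance, ⟨(MulEquiv.ofBijective F hf).symm⟩⟩

end CompletelyZeroSimple

/-! ### Excluding the trivial group, and the main equivalence. -/

theorem nontrivial_of_equiv_withZero {S G : Type*} (f : S ≃ WithZero G)
    (h2 : 2 < ENat.card S) : Nontrivial G := by
  by_contra hG
  rw [not_nontrivial_iff_subsingleton] at hG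
  have h1 : ENat.card G ≤ 1 := ENat.card_le_one_iff_subsingleton G |>.2 hG
  have : ENat.card (WithZero G) = ENat.card G + 1 := by
    let g : WithZero G ≃ G ⊕ Unit := Equiv.optionEquivSumPUnit G
    rw [ENat.card_congr g, ENat.card_sum]
    simp
  rw [ENat.card_congr f, this] at h2
  exact absurd (h2.trans_le (add_le_add_left h1 1)) (by decide)

theorem mainTheorem1 {S : Type*} [SemigroupWithZero S]
    (hS : IsCompletelyZeroSimple S) (hcard : 2 < ENat.card S)
    (hexc : ¬ IsRightZeroPairWithZero S) :
    IsRightSubdirectlyIrreducible S ↔ IsCocyclicZeroGroup S := by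
  constructor
  · intro h
    obtain ⟨hS, e, he⟩ := hS
    have hl := he.mul_eq_of_isRightSubdirectlyIrreducible hS h
    have hr : ∀ a : S, a ≠ 0 → ∃ t, a * t = e := fun a ha => he.exists_mul_eq hS ha (hl a)
    have hker : mulRightKernel e = ⊥ := by
      by_contra hker
      by_cases hL : leftGreenSetoid e hl = ⊥
      · exact hexc (h.isRightZeroPairWithZero hcard fun x y hx =>
          mul_eq_right_of_leftGreenSetoid_eq_bot he.1 hl hr hL hx y)
      · obtain ⟨x, y, h1, h2, hne⟩ := h.exists_common (isRightCongruence_mulRightKernel hl) hker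
          (isRightCongruence_leftGreenSetoid hl) hL
        exact hne (eq_of_mulRightKernel_of_leftGreenSetoid he.1 hl hr h1 h2)
    have hone : ∀ x, x * e = x := by
      intro x
      -- Idempotency of `e` puts `x * e` and `x` in one kernel class, and the kernel is equality.
      have hx : mulRightKernel e (x * e) x := by
        change x * e * e = x * e
        rw [mul_assoc, hl]
      rw [hker] at hx
      exact hx
    obtain ⟨G, _, ⟨f⟩⟩ := exists_group_mulEquiv_withZero he.1 hl
      (mul_ne_zero_of_left_identity he.1 hl hr) fun x hx => by
        simpa only [hone] using exists_left_inverse_mul he.1 hl hr hx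
    have := nontrivial_of_equiv_withZero f.toEquiv hcard
    exact ⟨G, _, (h.of_mulEquiv f).isCocyclicGroup, ⟨f⟩⟩
  · rintro ⟨G, _, hG, ⟨f⟩⟩
    exact hG.isRightSubdirectlyIrreducible_withZero.of_mulEquiv f.symm
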